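/- Let $E$ be a (real) Banach lattice with norm dual $E^*$, ordered by $f\le g$ iff $f(x)\le g(x)$ for all $x\ge 0$ in $E$. The $uaw$-topology on $E$ is the translation invariant topology in which the sets $$V_{u,\varepsilon,f}=\{x\in E : f(|x|\wedge u)<\varepsilon\},\qquad u\in E_+,\ \varepsilon>0,\ f\in E^*_+,$$ form a base of neighbourhoods of zero; equivalently, a net $(x_\alpha)$ converges to $x$ in it iff $|x_\alpha-x|\wedge u\to 0$ weakly for every $u\in E_+$. **Proposition.** Suppose that $E^*$ is order continuous, i.e. $\|f_\alpha\|\to 0$ for every net $f_\alpha\downarrow 0$ in $E^*$. Then every norm closed, convex, norm bounded subset $C$ of $E$ is closed in the $uaw$-topology. -/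

import Mathlib

open Filter Topology

universe u

section DualOrder

variable {E : Type*} [NormedAddCommGroup E] [NormedSpace ℝ E] [Lattice E] [IsOrderedAddMonoid E]

/-- The canonical order on the norm dual `E*` of a normed lattice:
`f ≤ g` iff `f x ≤ g x` for every `x ≥ 0`. -/
instance strongDualPartialOrder : PartialOrder (StrongDual ℝ E) where
  le f g := ∀ x : E, 0 ≤ x → f x ≤ g x
  le_refl _ _ _ := le_rfl
  le_trans _ _ _ h₁ h₂ x hx := (h₁ x hx).trans (h₂ x hx)
  le_antisymm f g h₁ h₂ := by
    have key : ∀ x : E, 0 ≤ x → f x = g x := fun x hx => le_antisymm (h₁ x hx) (h₂ x hx)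
    ext x
    rw [← posPart_sub_negPart x, map_sub, map_sub, key _ (posPart_nonneg x),
      key _ (negPart_nonneg x)]

theorem strongDual_le_iff {f g : StrongDual ℝ E} : f ≤ g ↔ ∀ x : E, 0 ≤ x → f x ≤ g x :=
  Iff.rfl

end DualOrder

/-- The norm of an ordered normed space `F` is order continuous: every decreasing net in `F` with
infimum `0` converges to `0` in norm. (It is enough to take index sets from the universe of `F`,
as the range of a decreasing net, with the reversed order, indexes a decreasing net.) -/
def OrderContinuousNorm (F : Type u) [NormedAddCommGroup F] [PartialOrder F] : Prop :=
  ∀ (ι : Type u) [Preorder ι] [IsDirectedOrder ι] [Nonempty ι] (x : ι → F),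
    Antitone x → IsGLB (Set.range x) 0 → Tendsto (fun i => ‖x i‖) atTop (𝓝 0)

section UAW

theorem abs_sub_inf_le {G : Type*} [AddCommGroup G] [Lattice G] [IsOrderedAddMonoid G]
    {u : G} (hu : 0 ≤ u) (x y z : G) :
    |z - x| ⊓ u ≤ |z - y| ⊓ u + |y - x| ⊓ u := by
  have h : |z - x| ≤ |z - y| + |y - x| := by
    have := abs_add_le (z - y) (y - x)
    simpa using this
  rw [add_inf, inf_add, inf_add]
  refine le_inf (le_inf (inf_le_left.trans h) ?_) (le_inf ?_ ?_)
  · exact inf_le_right.trans (le_add_of_nonneg_right (abs_nonneg _))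
  · exact inf_le_right.trans (le_add_of_nonneg_left (abs_nonneg _))
  · exact inf_le_right.trans (le_add_of_nonneg_right hu)

variable {E : Type*} [NormedAddCommGroup E] [NormedSpace ℝ E] [Lattice E] [IsOrderedAddMonoid E]

/-- The translate `x + V_{u,ε,f}` of the set `V_{u,ε,f} = {y : f (|y| ∧ u) < ε}`. -/
def uawBall (x u : E) (ε : ℝ) (f : StrongDual ℝ E) : Set E :=
  {y | f (|y - x| ⊓ u) < ε}

theorem uawBall_sup_subset {x u v : E} {ε δ : ℝ} {f g : StrongDual ℝ E} (hu : 0 ≤ u)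
    (hf : 0 ≤ f) (hg : 0 ≤ g) :
    uawBall x (u ⊔ v) (min ε δ) (f + g) ⊆ uawBall x u ε f ∩ uawBall x v δ g := by
  intro y hy
  have hy' : f (|y - x| ⊓ (u ⊔ v)) + g (|y - x| ⊓ (u ⊔ v)) < min ε δ := hy
  have mono : ∀ {h : StrongDual ℝ E}, 0 ≤ h → ∀ {a b : E}, a ≤ b → h a ≤ h b := by
    intro h hh a b hab
    have := hh (b - a) (sub_nonneg.2 hab)
    simpa using this
  have h0 : 0 ≤ |y - x| ⊓ (u ⊔ v) := le_inf (abs_nonneg _) (hu.trans le_sup_left)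
  have f0 : 0 ≤ f (|y - x| ⊓ (u ⊔ v)) := hf _ h0
  have g0 : 0 ≤ g (|y - x| ⊓ (u ⊔ v)) := hg _ h0
  have f1 : f (|y - x| ⊓ u) ≤ f (|y - x| ⊓ (u ⊔ v)) := mono hf (inf_le_inf_left _ le_sup_left)
  have g1 : g (|y - x| ⊓ v) ≤ g (|y - x| ⊓ (u ⊔ v)) := mono hg (inf_le_inf_left _ le_sup_right)
  have l := min_le_left ε δ
  have r := min_le_right ε δ
  constructor
  · change f (|y - x| ⊓ u) < ε
    linarith
  · change g (|y - x| ⊓ v) < δ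
    linarith

variable (E) in
/-- The `uaw`-topology of a Banach lattice `E`: the translation invariant topology in which the sets
`V_{u,ε,f}`, with `u ∈ E₊`, `ε > 0`, `f ∈ E*₊`, form a base of neighbourhoods of zero. -/
@[reducible] def uawTopology : TopologicalSpace E where
  IsOpen U := ∀ x ∈ U, ∃ u : E, 0 ≤ u ∧ ∃ ε : ℝ, 0 < ε ∧ ∃ f : StrongDual ℝ E, 0 ≤ f ∧
    uawBall x u ε f ⊆ U
  isOpen_univ _ _ := ⟨0, le_rfl, 1, one_pos, 0, le_rfl, Set.subset_univ _⟩
  isOpen_inter U V hU hV x hx := by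
    obtain ⟨u, hu, ε, hε, f, hf, h₁⟩ := hU x hx.1
    obtain ⟨v, hv, δ, hδ, g, hg, h₂⟩ := hV x hx.2
    refine ⟨u ⊔ v, hu.trans le_sup_left, min ε δ, lt_min hε hδ, f + g, ?_,
      (uawBall_sup_subset hu hf hg).trans (Set.inter_subset_inter h₁ h₂)⟩
    exact fun y hy => add_nonneg (hf y hy) (hg y hy)
  isOpen_sUnion S hS x hx := by
    obtain ⟨U, hU, hxU⟩ := hx
    obtain ⟨u, hu, ε, hε, f, hf, h⟩ := hS U hU x hxU
    exact ⟨u, hu, ε, hε, f, hf, h.trans (Set.subset_sUnion_of_mem hU)⟩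

/-- The sets `x + V_{u,ε,f}` do form a base of neighbourhoods of `x`. -/
theorem mem_nhds_uawTopology_iff {x : E} {s : Set E} :
    s ∈ @nhds E (uawTopology E) x ↔ ∃ u : E, 0 ≤ u ∧ ∃ ε : ℝ, 0 < ε ∧
      ∃ f : StrongDual ℝ E, 0 ≤ f ∧ uawBall x u ε f ⊆ s := by
  have self : ∀ {y u : E} {ε : ℝ} {f : StrongDual ℝ E}, 0 ≤ u → 0 < ε → y ∈ uawBall y u ε f := by
    intro y u ε f hu hε
    change f (|y - y| ⊓ u) < ε
    simpa [inf_eq_left.2 hu] using hε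
  rw [@mem_nhds_iff E (uawTopology E)]
  constructor
  · rintro ⟨t, hts, ht, hxt⟩
    obtain ⟨u, hu, ε, hε, f, hf, h⟩ := ht x hxt
    exact ⟨u, hu, ε, hε, f, hf, h.trans hts⟩
  · rintro hx
    refine ⟨{y | ∃ u : E, 0 ≤ u ∧ ∃ ε : ℝ, 0 < ε ∧
      ∃ f : StrongDual ℝ E, 0 ≤ f ∧ uawBall y u ε f ⊆ s}, ?_, ?_, hx⟩
    · rintro y ⟨u, hu, ε, hε, f, hf, h⟩
      exact h (self hu hε)
    · rintro y ⟨u, hu, ε, hε, f, hf, h⟩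
      refine ⟨u, hu, ε / 2, half_pos hε, f, hf, fun z hz => ⟨u, hu, ε / 2, half_pos hε, f, hf, ?_⟩⟩
      intro w hw
      apply h
      have hz' : f (|z - y| ⊓ u) < ε / 2 := hz
      have hw' : f (|w - z| ⊓ u) < ε / 2 := hw
      have := hf _ (sub_nonneg.2 (abs_sub_inf_le hu y z w))
      simp only [zero_apply, map_sub, map_add] at this
      change f (|w - y| ⊓ u) < ε
      linarith

end UAW

/-! Separate a point x from C by a functional g, and dominate g by a positive h. If `h (|z - x| ⊓
u)` is small, g can separate z from x only through `h (|z - x| - u)⁺`, so a single u making this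
tail small for all z in C suffices (`exists_forall_apply_posPart_sub_le`). If no such u exists, a
gliding hump gives bounded disjoint positive v n with `h (v n)` bounded away from 0 for large n. But
the components of h on the bands generated by the v n have partial sums below h, so order continuity
sends their norms to 0, hence `h (v n)` too (`tendsto_apply_zero_of_disjoint`). -/

theorem inf_eq_zero_of_le {G : Type*} [AddCommGroup G] [Lattice G] {a b c d : G} (ha : 0 ≤ a)
    (hb : 0 ≤ b) (hac : a ≤ c) (hbd : b ≤ d) (hcd : c ⊓ d = 0) : a ⊓ b = 0 :=
  le_antisymm ((inf_le_inf hac hbd).trans hcd.le) (le_inf ha hb)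

section LatticeGroup

variable {G : Type*} [AddCommGroup G] [Lattice G] [IsOrderedAddMonoid G]

theorem add_inf_le_inf_add_inf {a b c : G} (ha : 0 ≤ a) (hb : 0 ≤ b) (hc : 0 ≤ c) :
    (a + b) ⊓ c ≤ a ⊓ c + b ⊓ c := by
  rw [add_inf, inf_add, inf_add]
  refine le_inf (le_inf inf_le_left ?_) (le_inf ?_ ?_)
  · exact inf_le_right.trans (le_add_of_nonneg_right hb)
  · exact inf_le_right.trans (le_add_of_nonneg_left ha)
  · exact inf_le_right.trans (le_add_of_nonneg_right hc)

theorem add_inf_eq_zero {a b c : G} (ha : 0 ≤ a) (hb : 0 ≤ b) (hc : 0 ≤ c)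
    (hac : a ⊓ c = 0) (hbc : b ⊓ c = 0) : (a + b) ⊓ c = 0 := by
  refine le_antisymm ?_ (le_inf (add_nonneg ha hb) hc)
  simpa [hac, hbc] using add_inf_le_inf_add_inf ha hb hc

theorem nsmul_inf_eq_zero {a c : G} (ha : 0 ≤ a) (hc : 0 ≤ c) (hac : a ⊓ c = 0) (k : ℕ) :
    (k • a) ⊓ c = 0 := by
  induction k with
  | zero => simpa using hc
  | succ k ih =>
    rw [succ_nsmul]
    exact add_inf_eq_zero (nsmul_nonneg ha k) ha hc ih hac

/-- A sum of pairwise disjoint positive elements below `x` stays below `x`. -/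
theorem sum_le_of_pairwise_disjoint {x : G} (hx : 0 ≤ x) {w : ℕ → G} (hw : ∀ n, 0 ≤ w n)
    (hwx : ∀ n, w n ≤ x) (hd : ∀ m n, m < n → w m ⊓ w n = 0) (N : ℕ) :
    ∑ n ∈ Finset.range N, w n ≤ x := by
  induction N with
  | zero => simpa using hx
  | succ N ih =>
    have key : ∀ M ≤ N, (∑ n ∈ Finset.range M, w n) ⊓ w N = 0 := by
      intro M
      induction M with
      | zero => intro _; simpa using hw N
      | succ M ihM =>
        intro hM
        rw [Finset.sum_range_succ]
        exact add_inf_eq_zero (Finset.sum_nonneg fun n _ => hw n) (hw M) (hw N)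
          (ihM (by omega)) (hd M N (by omega))
    -- Disjoint summands: the sum equals the supremum.
    have h := inf_add_sup (∑ n ∈ Finset.range N, w n) (w N)
    rw [key N le_rfl, zero_add] at h
    rw [Finset.sum_range_succ, ← h]
    exact sup_le ih (hwx N)

end LatticeGroup

/-- Both terms come from one element t: the first is its positive part, the second lies below a
multiple of its negative part. -/
theorem posPart_inf_posPart_smul_eq_zero {F : Type*} [AddCommGroup F] [Module ℝ F] [Lattice F]
    [IsOrderedAddMonoid F] [IsOrderedModule ℝ F] {a b : F} (n : ℕ) :
    (a - ((4 : ℝ) ^ n)⁻¹ • b)⁺ ⊓ (b - (4 : ℝ) ^ n • a)⁺ = 0 := by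
  set t := a - ((4 : ℝ) ^ n)⁻¹ • b with ht
  have h4 : (4 : ℝ) ^ n ≠ 0 := by positivity
  have hb : b - (4 : ℝ) ^ n • a = (4 : ℝ) ^ n • (-t) := by
    rw [ht, neg_sub, smul_sub, smul_smul, mul_inv_cancel₀ h4, one_smul]
  have hle : (b - (4 : ℝ) ^ n • a)⁺ ≤ (4 ^ n : ℕ) • t⁻ := by
    rw [hb, posPart_def]
    refine sup_le ?_ (nsmul_nonneg (negPart_nonneg t) _)
    rw [← Nat.cast_smul_eq_nsmul ℝ]
    push_cast
    exact smul_le_smul_of_nonneg_left (neg_le_negPart t) (by positivity)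
  have hd : t⁺ ⊓ (4 ^ n : ℕ) • t⁻ = 0 := by
    rw [inf_comm]
    exact nsmul_inf_eq_zero (negPart_nonneg t) (posPart_nonneg t)
      (by rw [inf_comm]; exact posPart_inf_negPart_eq_zero t) _
  exact inf_eq_zero_of_le (posPart_nonneg _) (posPart_nonneg _) le_rfl hle hd

theorem apply_le_opNorm_mul {F : Type*} [NormedAddCommGroup F] [NormedSpace ℝ F]
    (h : StrongDual ℝ F) (x : F) : h x ≤ ‖h‖ * ‖x‖ :=
  (le_abs_self _).trans (h.le_opNorm x)

section NormedLattice

variable {E : Type*} [NormedAddCommGroup E] [Lattice E] [IsOrderedAddMonoid E] [HasSolidNorm E]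

theorem norm_posPart_le_norm (x : E) : ‖x⁺‖ ≤ ‖x‖ := by
  refine norm_le_norm_of_abs_le_abs ?_
  rw [abs_of_nonneg (posPart_nonneg x), posPart_def]
  exact sup_le (le_abs_self x) (abs_nonneg x)

theorem norm_le_norm_of_nonneg_of_le {x y : E} (hx : 0 ≤ x) (hxy : x ≤ y) : ‖x‖ ≤ ‖y‖ := by
  refine norm_le_norm_of_abs_le_abs ?_
  rwa [abs_of_nonneg hx, abs_of_nonneg (hx.trans hxy)]

end NormedLattice

section BanachLattice

variable {E : Type*} [NormedAddCommGroup E] [NormedSpace ℝ E] [Lattice E] [IsOrderedAddMonoid E]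

theorem strongDual_mono {h : StrongDual ℝ E} (hh : 0 ≤ h) {a b : E} (hab : a ≤ b) : h a ≤ h b := by
  have := hh (b - a) (sub_nonneg.2 hab)
  simpa using this

variable [HasSolidNorm E]

/-! ### Functionals built from the positive cone -/

/-- An additive, positive and bounded function on the positive cone of a normed lattice extends to a
continuous linear functional. -/
theorem exists_strongDual_of_additive (q : E → ℝ) (C : ℝ)
    (hadd : ∀ x y, 0 ≤ x → 0 ≤ y → q (x + y) = q x + q y) (h0 : ∀ x, 0 ≤ x → 0 ≤ q x)
    (hC : ∀ x, 0 ≤ x → q x ≤ C * ‖x‖) :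
    ∃ L : StrongDual ℝ E, ∀ x, 0 ≤ x → L x = q x := by
  have q0 : q 0 = 0 := by
    have := hadd 0 0 le_rfl le_rfl
    simp only [add_zero] at this
    linarith
  let A : E →+ ℝ :=
    { toFun := fun x => q x⁺ - q x⁻
      map_zero' := by simp
      map_add' := fun x y => by
        have h : (x + y)⁺ + (x⁻ + y⁻) = (x⁺ + y⁺) + (x + y)⁻ := by
          have e := posPart_sub_negPart (x + y)
          have e1 := posPart_sub_negPart x
          have e2 := posPart_sub_negPart y
          rw [← sub_eq_zero]
          calc _ = ((x + y)⁺ - (x + y)⁻) - (x⁺ - x⁻) - (y⁺ - y⁻) := by abel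
            _ = 0 := by rw [e, e1, e2]; abel
        have h' := congrArg q h
        have px := posPart_nonneg x
        have py := posPart_nonneg y
        have pz := posPart_nonneg (x + y)
        have nx := negPart_nonneg x
        have ny := negPart_nonneg y
        have nz := negPart_nonneg (x + y)
        rw [hadd _ _ pz (add_nonneg nx ny), hadd _ _ nx ny, hadd _ _ (add_nonneg px py) nz,
          hadd _ _ px py] at h'
        linarith }
  have hA : ∀ x, A x = q x⁺ - q x⁻ := fun _ => rfl
  -- Continuity upgrades additivity to real linearity, so q need not be assumed homogeneous.
  have hcont : Continuous A := by
    refine AddMonoidHomClass.continuous_of_bound A |C| fun x => ?_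
    have bound : ∀ z : E, q z⁺ ≤ |C| * ‖z‖ := fun z =>
      (hC _ (posPart_nonneg z)).trans (mul_le_mul (le_abs_self C) (norm_posPart_le_norm z)
        (norm_nonneg _) (abs_nonneg C))
    have b1 := bound x
    have b2 := bound (-x)
    rw [posPart_neg, norm_neg] at b2
    have p1 := h0 _ (posPart_nonneg x)
    have p2 := h0 _ (negPart_nonneg x)
    rw [hA, Real.norm_eq_abs, abs_le]
    constructor <;> linarith
  refine ⟨A.toRealLinearMap hcont, fun x hx => ?_⟩
  change q x⁺ - q x⁻ = q x
  rw [posPart_of_nonneg hx, negPart_of_nonneg hx, q0, sub_zero]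

/-- Every continuous functional on a normed lattice is dominated by a positive one. -/
theorem exists_strongDual_dominating (g : StrongDual ℝ E) :
    ∃ h : StrongDual ℝ E, 0 ≤ h ∧ ∀ z, g z ≤ h |z| := by
  -- Riesz–Kantorovich: the supremum of T x is the value at x of the positive part of g.
  let T : E → Set ℝ := fun x => g '' Set.Icc 0 x
  have hB : ∀ x, ∀ t ∈ T x, t ≤ ‖g‖ * ‖x‖ := by
    rintro x t ⟨y, hy, rfl⟩
    exact (le_abs_self _).trans ((g.le_opNorm y).trans (mul_le_mul_of_nonneg_left
      (norm_le_norm_of_nonneg_of_le hy.1 hy.2) (norm_nonneg g)))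
  have hBdd : ∀ x, BddAbove (T x) := fun x => ⟨_, hB x⟩
  have hle : ∀ x y, 0 ≤ y → y ≤ x → g y ≤ sSup (T x) := fun x y h1 h2 =>
    le_csSup (hBdd x) ⟨y, ⟨h1, h2⟩, rfl⟩
  have hne : ∀ x, 0 ≤ x → (T x).Nonempty := fun x hx => ⟨_, 0, ⟨le_rfl, hx⟩, rfl⟩
  obtain ⟨L, hL⟩ := exists_strongDual_of_additive (fun x => sSup (T x)) ‖g‖ (by
      intro x y hx hy
      apply le_antisymm
      · refine csSup_le (hne _ (add_nonneg hx hy)) ?_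
        rintro _ ⟨z, hz, rfl⟩
        have h1 := hle x (z ⊓ x) (le_inf hz.1 hx) inf_le_right
        have h2 := hle y (z - z ⊓ x) (sub_nonneg.2 inf_le_left) (by
          rw [sub_le_iff_le_add', inf_add]
          exact le_inf (le_add_of_nonneg_right hy) hz.2)
        rw [map_sub] at h2
        linarith
      · rw [← le_sub_iff_add_le]
        refine csSup_le (hne _ hx) ?_
        rintro _ ⟨z, hz, rfl⟩
        rw [le_sub_comm]
        refine csSup_le (hne _ hy) ?_
        rintro _ ⟨w, hw, rfl⟩
        have := hle (x + y) (z + w) (add_nonneg hz.1 hw.1) (add_le_add hz.2 hw.2)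
        rw [map_add] at this
        linarith)
    (fun x hx => by simpa using hle x 0 le_rfl hx)
    (fun x hx => csSup_le (hne x hx) (hB x))
  have hLg : ∀ x, 0 ≤ x → g x ≤ L x := fun x hx => by rw [hL x hx]; exact hle x x hx le_rfl
  have hL0 : ∀ x, 0 ≤ x → 0 ≤ L x := fun x hx => by
    rw [hL x hx]; simpa using hle x 0 le_rfl hx
  -- With L the positive part of g, this is the modulus of g.
  refine ⟨L + (L - g), fun x hx => ?_, fun z => ?_⟩
  · have h1 := hLg x hx
    have h2 := hL0 x hx
    change (0 : ℝ) ≤ L x + (L x - g x)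
    linarith
  · have e1 := hLg _ (posPart_nonneg z)
    have e2 := hL0 _ (negPart_nonneg z)
    have e3 := hL0 _ (posPart_nonneg z)
    have e4 := hLg _ (negPart_nonneg z)
    have ez : g z = g z⁺ - g z⁻ := by rw [← map_sub, posPart_sub_negPart]
    rw [← posPart_add_negPart z]
    change g z ≤ L (z⁺ + z⁻) + (L (z⁺ + z⁻) - g (z⁺ + z⁻))
    rw [map_add, map_add]
    linarith

/-- The component of a positive functional `h` carried by the principal band generated by `v`. -/
theorem exists_component {h : StrongDual ℝ E} (hh : 0 ≤ h) {v : E} (hv : 0 ≤ v) :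
    ∃ L : StrongDual ℝ E, ∀ x, 0 ≤ x →
      Tendsto (fun k : ℕ => h (x ⊓ k • v)) atTop (𝓝 (L x)) := by
  have hlim : ∀ x, Tendsto (fun k : ℕ => h (x ⊓ k • v)) atTop
      (𝓝 (⨆ k : ℕ, h (x ⊓ k • v))) := fun x => by
    refine tendsto_atTop_ciSup (fun k l hkl => ?_) ⟨h x, ?_⟩
    · exact strongDual_mono hh (inf_le_inf_left x (nsmul_le_nsmul_left hv hkl))
    · rintro _ ⟨k, rfl⟩
      exact strongDual_mono hh inf_le_left
  obtain ⟨L, hL⟩ := exists_strongDual_of_additive (fun x => ⨆ k : ℕ, h (x ⊓ k • v)) ‖h‖ (by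
      intro x y hx hy
      have hsum := (hlim x).add (hlim y)
      apply le_antisymm
      · refine le_of_tendsto_of_tendsto' (hlim (x + y)) hsum fun k => ?_
        rw [← map_add]
        exact strongDual_mono hh (add_inf_le_inf_add_inf hx hy (nsmul_nonneg hv k))
      · have h2 : Tendsto (fun k : ℕ => k + k) atTop atTop :=
          tendsto_atTop_mono (fun k => Nat.le_add_left k k) tendsto_id
        refine le_of_tendsto_of_tendsto' hsum ((hlim (x + y)).comp h2) fun k => ?_
        rw [← map_add]
        refine strongDual_mono hh (le_inf (add_le_add inf_le_left inf_le_left) ?_)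
        rw [add_nsmul]
        exact add_le_add inf_le_right inf_le_right)
    (fun x hx => ge_of_tendsto' (hlim x) fun k => hh _ (le_inf hx (nsmul_nonneg hv k)))
    (fun x hx => le_of_tendsto' (hlim x) fun k =>
      (strongDual_mono hh inf_le_left).trans (apply_le_opNorm_mul h x))
  exact ⟨L, fun x hx => by rw [hL x hx]; exact hlim x⟩

/-! ### Consequences of order continuity -/

/-- If the dual norm is order continuous, positive functionals whose partial sums are dominated by a
functional tend to zero in norm. -/
theorem tendsto_norm_zero_of_sum_le (hE : OrderContinuousNorm (StrongDual ℝ E))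
    {h : StrongDual ℝ E} {L : ℕ → StrongDual ℝ E} (hL : ∀ n x, 0 ≤ x → 0 ≤ L n x)
    (hsum : ∀ N x, 0 ≤ x → ∑ n ∈ Finset.range N, L n x ≤ h x) :
    Tendsto (fun n => ‖L n‖) atTop (𝓝 0) := by
  have hs : ∀ x, 0 ≤ x → Summable fun n => L n x := fun x hx =>
    summable_of_sum_range_le (fun n => hL n x hx) fun N => hsum N x hx
  obtain ⟨S, hS⟩ := exists_strongDual_of_additive (fun x => ∑' n, L n x) ‖h‖
    (fun x y hx hy => by
      simp only [map_add]
      exact (hs x hx).tsum_add (hs y hy))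
    (fun x hx => tsum_nonneg fun n => hL n x hx)
    (fun x hx => (Real.tsum_le_of_sum_range_le (fun n => hL n x hx) fun N => hsum N x hx).trans
      (apply_le_opNorm_mul h x))
  -- The tails of the series decrease to 0, and each L n is a difference of consecutive tails.
  let R : ℕ → StrongDual ℝ E := fun N => S - ∑ n ∈ Finset.range N, L n
  have hR : ∀ N x, R N x = S x - ∑ n ∈ Finset.range N, L n x := fun N x => by
    simp [R]
  have hRlim : ∀ x, 0 ≤ x → Tendsto (fun N => R N x) atTop (𝓝 0) := fun x hx => by
    have := (hs x hx).hasSum.tendsto_sum_nat.const_sub (S x)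
    rw [← hS x hx, sub_self] at this
    simpa only [hR] using this
  have hanti : Antitone R := antitone_nat_of_succ_le fun N x hx => by
    rw [hR, hR, Finset.sum_range_succ]
    have := hL N x hx
    linarith
  have hglb : IsGLB (Set.range fun i : ULift ℕ => R i.down) 0 := by
    constructor
    · rintro _ ⟨i, rfl⟩ x hx
      have := (hs x hx).sum_le_tsum (Finset.range i.down) fun n _ => hL n x hx
      change (0 : ℝ) ≤ R i.down x
      rw [hR, hS x hx]
      linarith
    · intro f hf x hx
      exact ge_of_tendsto' (hRlim x hx) fun N => hf ⟨ULift.up N, rfl⟩ x hx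
  have hnorm := hE (ULift ℕ) (fun i => R i.down) (fun i j hij => hanti hij) hglb
  have hup : Tendsto (fun n : ℕ => (ULift.up n : ULift ℕ)) atTop atTop :=
    tendsto_atTop.2 fun b => (eventually_ge_atTop b.down).mono fun n hn => hn
  have hR0 : Tendsto (fun n => ‖R n‖) atTop (𝓝 0) := hnorm.comp hup
  have hadd := hR0.add (hR0.comp (tendsto_add_atTop_nat 1))
  rw [add_zero] at hadd
  refine squeeze_zero (fun n => norm_nonneg _) (fun n => ?_) hadd
  have : L n = R n - R (n + 1) := by
    simp only [R, Finset.sum_range_succ]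
    abel
  rw [this]
  exact norm_sub_le _ _

/-- If the dual norm is order continuous, norm bounded disjoint positive sequences are null for every
positive functional. -/
theorem tendsto_apply_zero_of_disjoint (hE : OrderContinuousNorm (StrongDual ℝ E))
    {h : StrongDual ℝ E} (hh : 0 ≤ h) {v : ℕ → E} (hv : ∀ n, 0 ≤ v n)
    (hd : ∀ m n, m < n → v m ⊓ v n = 0) {M : ℝ} (hM : ∀ n, ‖v n‖ ≤ M) :
    Tendsto (fun n => h (v n)) atTop (𝓝 0) := by
  choose L hL using fun n => exists_component hh (hv n)
  have hn : Tendsto (fun n => ‖L n‖) atTop (𝓝 0) := by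
    refine tendsto_norm_zero_of_sum_le hE (h := h) (fun n x hx => ?_) fun N x hx => ?_
    · exact ge_of_tendsto' (hL n x hx) fun k => hh _ (le_inf hx (nsmul_nonneg (hv n) k))
    · refine le_of_tendsto' (tendsto_finsetSum _ fun n _ => hL n x hx) fun k => ?_
      rw [← map_sum]
      refine strongDual_mono hh (sum_le_of_pairwise_disjoint hx
        (fun n => le_inf hx (nsmul_nonneg (hv n) k)) (fun n => inf_le_left) (fun m n hmn => ?_) N)
      have h1 := nsmul_inf_eq_zero (hv m) (hv n) (hd m n hmn) k
      rw [inf_comm] at h1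
      have h2 := nsmul_inf_eq_zero (hv n) (nsmul_nonneg (hv m) k) h1 k
      rw [inf_comm] at h2
      exact inf_eq_zero_of_le (le_inf hx (nsmul_nonneg (hv m) k))
        (le_inf hx (nsmul_nonneg (hv n) k)) inf_le_right inf_le_right h2
  have hb := hn.mul_const M
  rw [zero_mul] at hb
  refine squeeze_zero (fun n => hh _ (hv n)) (fun n => ?_) hb
  have hLv : L n (v n) = h (v n) := by
    refine tendsto_nhds_unique (hL n (v n) (hv n)) (tendsto_const_nhds.congr' ?_)
    filter_upwards [eventually_ge_atTop 1] with k hk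
    have : v n ≤ k • v n := by simpa using nsmul_le_nsmul_left (hv n) hk
    rw [inf_eq_left.2 this]
  rw [← hLv]
  exact (apply_le_opNorm_mul _ _).trans (mul_le_mul_of_nonneg_left (hM n) (norm_nonneg _))

variable [CompleteSpace E] [IsOrderedModule ℝ E]

/-- If the dual norm is order continuous, norm bounded sets are almost order bounded with respect to
each positive functional. -/
theorem exists_forall_apply_posPart_sub_le (hE : OrderContinuousNorm (StrongDual ℝ E))
    {h : StrongDual ℝ E} (hh : 0 ≤ h) (M : ℝ) {ε : ℝ} (hε : 0 < ε) :
    ∃ u : E, 0 ≤ u ∧ ∀ a : E, 0 ≤ a → ‖a‖ ≤ M → h (a - u)⁺ ≤ ε := by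
  by_contra! hcon
  choose! F hF0 hFM hFh using hcon
  -- S n is the sum of the earlier a m; a n violates the bound for u = 4^n S n.
  let S : ℕ → E := fun n => Nat.rec 0 (fun k s => s + F ((4 : ℝ) ^ k • s)) n
  let a : ℕ → E := fun n => F ((4 : ℝ) ^ n • S n)
  have hSsucc : ∀ n, S (n + 1) = S n + a n := fun n => rfl
  have hS0 : ∀ n, 0 ≤ S n := fun n => by
    induction n with
    | zero => exact le_rfl
    | succ n ih => rw [hSsucc]; exact add_nonneg ih (hF0 _ (smul_nonneg (by positivity) ih))
  have hu : ∀ n, 0 ≤ (4 : ℝ) ^ n • S n := fun n => smul_nonneg (by positivity) (hS0 n)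
  have ha0 : ∀ n, 0 ≤ a n := fun n => hF0 _ (hu n)
  have haM : ∀ n, ‖a n‖ ≤ M := fun n => hFM _ (hu n)
  have hah : ∀ n, ε < h (a n - (4 : ℝ) ^ n • S n)⁺ := fun n => hFh _ (hu n)
  have hSmono : Monotone S := monotone_nat_of_le_succ fun n => by
    rw [hSsucc]; exact le_add_of_nonneg_right (ha0 n)
  have haS : ∀ m n, m < n → a m ≤ S n := fun m n hmn =>
    (le_add_of_nonneg_left (hS0 m)).trans ((hSsucc m).symm.le.trans (hSmono hmn))
  have hsm : Summable fun n => (1 / 2 : ℝ) ^ n • a n := by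
    refine Summable.of_norm_bounded (summable_geometric_two.mul_right M) fun n => ?_
    rw [norm_smul, Real.norm_of_nonneg (by positivity)]
    exact mul_le_mul_of_nonneg_left (haM n) (by positivity)
  let y : E := ∑' n, (1 / 2 : ℝ) ^ n • a n
  have hay : ∀ n, (1 / 2 : ℝ) ^ n • a n ≤ y := fun n =>
    hsm.le_tsum n fun m _ => smul_nonneg (by positivity) (ha0 m)
  have hy : 0 ≤ y := tsum_nonneg fun n => smul_nonneg (by positivity) (ha0 n)
  -- For m < n, subtracting 2^-m y puts v m below (a m - 4^-n a n)⁺, and subtracting 4^n S n puts v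
  -- n below (a n - 4^n a m)⁺; these are disjoint.
  let v : ℕ → E := fun n => (a n - (4 : ℝ) ^ n • S n - (1 / 2 : ℝ) ^ n • y)⁺
  have hyn : ∀ n, 0 ≤ (1 / 2 : ℝ) ^ n • y := fun n => smul_nonneg (by positivity) hy
  have hv0 : ∀ n, 0 ≤ v n := fun n => posPart_nonneg _
  have hvM : ∀ n, ‖v n‖ ≤ M := fun n => by
    refine (norm_le_norm_of_nonneg_of_le (hv0 n) ?_).trans (haM n)
    refine sup_le ?_ (ha0 n)
    exact (sub_le_self _ (hyn n)).trans (sub_le_self _ (hu n))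
  have hd : ∀ m n, m < n → v m ⊓ v n = 0 := fun m n hmn => by
    refine inf_eq_zero_of_le (hv0 m) (hv0 n) (posPart_mono ?_) (posPart_mono ?_)
      (posPart_inf_posPart_smul_eq_zero (a := a m) (b := a n) n)
    · refine sub_le_sub (sub_le_self _ (hu m)) ?_
      calc ((4 : ℝ) ^ n)⁻¹ • a n ≤ ((1 / 2 : ℝ) ^ m * (1 / 2 : ℝ) ^ n) • a n := by
            refine smul_le_smul_of_nonneg_right ?_ (ha0 n)
            have e : ((4 : ℝ) ^ n)⁻¹ = (1 / 2 : ℝ) ^ n * (1 / 2 : ℝ) ^ n := by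
              rw [← mul_pow, ← inv_pow]; norm_num
            rw [e]
            exact mul_le_mul_of_nonneg_right
              (pow_le_pow_of_le_one (by norm_num) (by norm_num) hmn.le) (by positivity)
        _ ≤ (1 / 2 : ℝ) ^ m • y := by
            rw [mul_smul]
            exact smul_le_smul_of_nonneg_left (hay n) (by positivity)
    · refine (sub_le_self _ (hyn n)).trans (sub_le_sub_left ?_ _)
      exact smul_le_smul_of_nonneg_left (haS m n hmn) (by positivity)
  have hlow : ∀ n, ε ≤ h (v n) + (1 / 2 : ℝ) ^ n * h y := fun n => by
    refine (hah n).le.trans ?_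
    have : (a n - (4 : ℝ) ^ n • S n)⁺ ≤ v n + (1 / 2 : ℝ) ^ n • y := by
      refine sup_le ?_ (add_nonneg (hv0 n) (hyn n))
      rw [← sub_le_iff_le_add]
      exact le_posPart _
    simpa using strongDual_mono hh this
  have hlim := (tendsto_apply_zero_of_disjoint hE hh hv0 hd hvM).add
    ((tendsto_pow_atTop_nhds_zero_of_lt_one (r := (1 / 2 : ℝ)) (by norm_num)
      (by norm_num)).mul_const (h y))
  have := ge_of_tendsto' hlim hlow
  simp only [zero_mul, add_zero] at this
  linarith

end BanachLattice

theorem mainTheorem9 {E : Type*} [NormedAddCommGroup E] [NormedSpace ℝ E] [CompleteSpace E]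
    [Lattice E] [IsOrderedAddMonoid E] [IsOrderedModule ℝ E] [HasSolidNorm E]
    (hE : OrderContinuousNorm (StrongDual ℝ E))
    (C : Set E) (hclosed : IsClosed C) (hconv : Convex ℝ C) (hbdd : Bornology.IsBounded C) :
    IsClosed[uawTopology E] C := by
  refine (@isOpen_compl_iff E C (uawTopology E)).1 fun x hx => ?_
  obtain ⟨g, s, hgx, hgC⟩ := geometric_hahn_banach_point_closed hconv hclosed hx
  obtain ⟨h, hh, hgh⟩ := exists_strongDual_dominating g
  obtain ⟨K, hK⟩ := hbdd.exists_norm_le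
  -- Half the gap for each of the two pieces of |z - x|.
  have hε : 0 < (s - g x) / 2 := by linarith
  obtain ⟨u, hu, hub⟩ := exists_forall_apply_posPart_sub_le hE hh (K + ‖x‖) hε
  refine ⟨u, hu, (s - g x) / 2, hε, h, hh, fun z hz hzC => ?_⟩
  have h1 : h (|z - x| ⊓ u) < (s - g x) / 2 := hz
  have h2 := hub |z - x| (abs_nonneg _) (by
    rw [norm_abs_eq_norm]
    exact (norm_sub_le z x).trans (by linarith [hK z hzC]))
  have h3 := hgh (z - x)
  have h4 : |z - x| = |z - x| ⊓ u + (|z - x| - u)⁺ := by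
    rw [posPart_def, ← sub_eq_iff_eq_add', sub_inf, sub_self, sup_comm]
  rw [h4, map_add, map_sub] at h3
  linarith [hgC z hzC]
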